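/- For real $\nu$ and $x>0$ let $K_\nu(x)=\int_0^\infty e^{-x\cosh t}\cosh(\nu t)\,dt$ be the modified Bessel function of the second kind, and for $\alpha\in\mathbb R$ put $$d_\alpha(\nu,x)=\frac{x}{\tau+\sqrt{\tau^2+x^2}},\qquad \tau=\nu-\tfrac12(\alpha+1).$$ (i) For all $\nu\ge 1/2$ and $x>0$, $$\frac{K_{\nu-1}(x)}{K_\nu(x)}\ \ge\ d_0(\nu,x)=\frac{x}{\nu-1/2+\sqrt{(\nu-1/2)^2+x^2}},$$ with equality if and only if $\nu=1/2$. (ii) For all real $\nu$ and all $x>0$, $$\frac{K_{\nu-1}(x)}{K_\nu(x)}\ <\ d_1(\nu,x)=\frac{x}{\nu-1+\sqrt{(\nu-1)^2+x^2}}.$$ (iii) These bounds are the best possible of the form $d_\alpha(\nu,x)$, $\alpha\in\mathbb R$, in their range of validity. That is, for all real $\nu$ and $x>0$, $d_\alpha(\nu,x)$ is strictly increasing in $\alpha$, and: for every fixed $\nu\ge 1/2$ and $\alpha\in\mathbb R$, the inequality $d_\alpha(\nu,x)\le K_{\nu-1}(x)/K_\nu(x)$ holds for all $x>0$ if and only if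 $\alpha\le 0$; for every $\alpha\in\mathbb R$, the inequality $K_{\nu-1}(x)/K_\nu(x)\le d_\alpha(\nu,x)$ holds for all real $\nu$ and all $x>0$ if and only if $\alpha\ge 1$; and for every fixed $\nu>1$ and $\alpha\in\mathbb R$, the latter inequality holds for all $x>0$ if and only if $\alpha\ge1$. -/

import Mathlib

/-- The modified Bessel function of the second kind `K_ν(x)` of real order `ν`, at real `x > 0`,
defined by its standard integral
`K_ν(x) = ∫₀^∞ exp (-x cosh t) cosh (ν t) dt` (absolutely convergent for every `x > 0`). -/
noncomputable def besselK (ν x : ℝ) : ℝ :=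
  ∫ t in Set.Ioi (0 : ℝ), Real.exp (-(x * Real.cosh t)) * Real.cosh (ν * t)

/-- The family `d_α(ν, x) = x / (τ + √(τ² + x²))`, where `τ = ν - (α + 1) / 2`.
The denominator is positive for every `x > 0`. -/
noncomputable def dBound (α ν x : ℝ) : ℝ :=
  x / ((ν - (α + 1) / 2) + Real.sqrt ((ν - (α + 1) / 2) ^ 2 + x ^ 2))

/-! Put `r = K_{ν-1}(x)/K_ν(x)`. As `d_α` is the positive root of `x r² + 2τ r = x`, each bound is a
quadratic inequality in `r`, which the three-term recurrence turns into an inequality between Bessel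
functions. For `α = 1` it is strict log-convexity in the order (`besselK_sq_lt`). For `α = 0` and `ν
> 1/2` it is Chebyshev's inequality (`besselK_chebyshev`): under the weight `exp (-x cosh t) cosh (ν
t)`, the decreasing function `cosh ((ν-1)t) / cosh (νt)` and the increasing `cosh t` are negatively
correlated. At `ν = 1/2`, evenness in the order gives `r = 1`.

Optimality of `α = 0` is seen as `x → ∞`, where `r ≈ 1 - (ν-1/2)/x` and `d_α ≈ 1 - τ/x`, with `τ = ν
- 1/2 - α/2`. Optimality of `α = 1` is seen as `x → 0`: for `ν > 1`, `r ≈ x/(2(ν-1))`, while `d_α ≈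
x/(2τ)` with `τ > ν - 1` if `α < 1`. -/

/-! ### Convergence, decay and positivity -/

theorem besselK_integrand_bound (ν x t : ℝ) (hx : 0 < x) (ht : 0 ≤ t) :
    Real.exp (-(x * Real.cosh t)) * Real.exp (|ν| * t) ≤
      Real.exp ((|ν| + 1) ^ 2 / x) * Real.exp (-t) := by
  have h1 : t ^ 2 / 4 ≤ Real.cosh t := by
    have := Real.quadratic_le_exp_of_nonneg ht
    have h2 := Real.exp_pos (-t)
    rw [Real.cosh_eq]
    linarith
  rw [← Real.exp_add, ← Real.exp_add, Real.exp_le_exp]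
  -- Completing the square absorbs the linear exponent into the quadratic lower bound for `cosh`.
  have h3 : (|ν| + 1) ^ 2 / x + x * (t ^ 2 / 4) - (|ν| + 1) * t
      = (|ν| + 1 - x * t / 2) ^ 2 / x := by field_simp; ring
  have h4 : 0 ≤ (|ν| + 1 - x * t / 2) ^ 2 / x := by positivity
  nlinarith [mul_le_mul_of_nonneg_left h1 hx.le]

theorem cosh_mul_le_exp_abs_mul (ν t : ℝ) (ht : 0 ≤ t) :
    Real.cosh (ν * t) ≤ Real.exp (|ν| * t) := by
  rw [← Real.cosh_abs, abs_mul, abs_of_nonneg ht, Real.cosh_eq]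
  have : Real.exp (-(|ν| * t)) ≤ Real.exp (|ν| * t) :=
    Real.exp_le_exp.2 (by have : 0 ≤ |ν| * t := by positivity
                          linarith)
  linarith

theorem integrableOn_besselK_integrand (ν x : ℝ) (hx : 0 < x) :
    MeasureTheory.IntegrableOn
      (fun t => Real.exp (-(x * Real.cosh t)) * Real.cosh (ν * t)) (Set.Ioi 0) := by
  have hg := (exp_neg_integrableOn_Ioi 0 one_pos).const_mul (Real.exp ((|ν| + 1) ^ 2 / x))
  refine hg.mono' (Continuous.aestronglyMeasurable (by fun_prop)) ?_
  filter_upwards [MeasureTheory.ae_restrict_mem measurableSet_Ioi] with t ht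
  have ht : 0 ≤ t := (Set.mem_Ioi.1 ht).le
  rw [Real.norm_of_nonneg (by positivity), neg_one_mul]
  exact (mul_le_mul_of_nonneg_left (cosh_mul_le_exp_abs_mul ν t ht) (by positivity)).trans
    (besselK_integrand_bound ν x t hx ht)

theorem tendsto_exp_neg_cosh_mul_sinh (ν x : ℝ) (hx : 0 < x) :
    Filter.Tendsto (fun t => Real.exp (-(x * Real.cosh t)) * Real.sinh (ν * t))
      Filter.atTop (nhds 0) := by
  have h0 : Filter.Tendsto (fun t : ℝ => Real.exp ((|ν| + 1) ^ 2 / x) * Real.exp (-t))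
      Filter.atTop (nhds 0) := by
    simpa using (Real.tendsto_exp_neg_atTop_nhds_zero).const_mul (Real.exp ((|ν| + 1) ^ 2 / x))
  refine squeeze_zero_norm' ?_ h0
  filter_upwards [Filter.eventually_ge_atTop 0] with t ht
  rw [norm_mul, Real.norm_of_nonneg (Real.exp_pos _).le, Real.norm_eq_abs]
  refine le_trans (mul_le_mul_of_nonneg_left ?_ (by positivity))
    (besselK_integrand_bound ν x t hx ht)
  refine le_trans ?_ (cosh_mul_le_exp_abs_mul ν t ht)
  have h1 := Real.exp_pos (ν * t)
  have h2 := Real.exp_pos (-(ν * t))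
  rw [Real.cosh_eq, Real.sinh_eq, abs_le]
  constructor <;> linarith

theorem setIntegral_Ioi_pos_of_ne {f : ℝ → ℝ} (t₀ : ℝ)
    (hf : MeasureTheory.IntegrableOn f (Set.Ioi 0))
    (h0 : ∀ t, 0 < t → 0 ≤ f t) (hpos : ∀ t, 0 < t → t ≠ t₀ → 0 < f t) :
    0 < ∫ t in Set.Ioi (0 : ℝ), f t := by
  rw [MeasureTheory.setIntegral_pos_iff_support_of_nonneg_ae _ hf]
  · have hsub : Set.Ioi (max 0 t₀) ⊆ Function.support f ∩ Set.Ioi 0 := by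
      intro t ht
      obtain ⟨h1, h2⟩ := max_lt_iff.1 (Set.mem_Ioi.1 ht)
      exact ⟨(hpos t h1 h2.ne').ne', h1⟩
    refine lt_of_lt_of_le ?_ (MeasureTheory.measure_mono hsub)
    simp
  · filter_upwards [MeasureTheory.ae_restrict_mem measurableSet_Ioi] with t ht using h0 t ht

theorem besselK_pos (ν x : ℝ) (hx : 0 < x) : 0 < besselK ν x :=
  setIntegral_Ioi_pos_of_ne 0 (integrableOn_besselK_integrand ν x hx)
    (fun t _ => by positivity) (fun t _ _ => by positivity)

theorem besselK_neg (ν x : ℝ) : besselK (-ν) x = besselK ν x := by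
  simp only [besselK, neg_mul, Real.cosh_neg]

/-! ### Recurrence, log-convexity and Chebyshev's inequality -/

/-- Integrate the derivative of `exp (-x cosh t) sinh (νt)`, which vanishes at both ends. -/
theorem besselK_recurrence (ν x : ℝ) (hx : 0 < x) :
    x * (besselK (ν + 1) x - besselK (ν - 1) x) = 2 * ν * besselK ν x := by
  have hp := integrableOn_besselK_integrand (ν + 1) x hx
  have hm := integrableOn_besselK_integrand (ν - 1) x hx
  have hn := integrableOn_besselK_integrand ν x hx
  have hderiv : ∀ t ∈ Set.Ici (0 : ℝ),
      HasDerivAt (fun t => Real.exp (-(x * Real.cosh t)) * Real.sinh (ν * t))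
        (ν * (Real.exp (-(x * Real.cosh t)) * Real.cosh (ν * t)) -
          x / 2 * (Real.exp (-(x * Real.cosh t)) * Real.cosh ((ν + 1) * t) -
            Real.exp (-(x * Real.cosh t)) * Real.cosh ((ν - 1) * t))) t := by
    intro t _
    have h1 := (((Real.hasDerivAt_cosh t).const_mul x).neg).exp
    have h2 := ((hasDerivAt_id t).const_mul ν).sinh
    refine (h1.mul h2).congr_deriv ?_
    simp only [Pi.neg_apply, id]
    rw [show (ν + 1) * t = ν * t + t by ring, show (ν - 1) * t = ν * t - t by ring,
      Real.cosh_add, Real.cosh_sub]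
    ring
  have key := MeasureTheory.integral_Ioi_of_hasDerivAt_of_tendsto'
    hderiv ((hn.const_mul ν).sub ((hp.sub hm).const_mul (x / 2)))
    (tendsto_exp_neg_cosh_mul_sinh ν x hx)
  erw [MeasureTheory.integral_sub (hn.const_mul ν) ((hp.sub hm).const_mul (x / 2)),
    MeasureTheory.integral_const_mul, MeasureTheory.integral_const_mul,
    MeasureTheory.integral_sub hp hm] at key
  simp only [mul_zero, Real.sinh_zero, sub_zero] at key
  unfold besselK
  linarith

theorem besselK_sq_lt (ν x : ℝ) (hx : 0 < x) :
    besselK ν x ^ 2 < besselK (ν - 1) x * besselK (ν + 1) x := by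
  have hp := integrableOn_besselK_integrand (ν + 1) x hx
  have hm := integrableOn_besselK_integrand (ν - 1) x hx
  have hn := integrableOn_besselK_integrand ν x hx
  have hmpos := besselK_pos (ν - 1) x hx
  -- The minimiser of the integrated quadratic `K_{ν+1} - 2s K_ν + s² K_{ν-1}`.
  set s := besselK ν x / besselK (ν - 1) x with hs
  have hpt : ∀ t : ℝ, 0 < t → 0 < Real.exp (-(x * Real.cosh t)) * Real.cosh ((ν + 1) * t) -
      2 * s * (Real.exp (-(x * Real.cosh t)) * Real.cosh (ν * t)) +
      s ^ 2 * (Real.exp (-(x * Real.cosh t)) * Real.cosh ((ν - 1) * t)) := by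
    intro t ht
    have hst : 0 < Real.sinh t := Real.sinh_pos_iff.2 ht
    have e1 : Real.cosh ((ν + 1) * t) - 2 * s * Real.cosh (ν * t) +
        s ^ 2 * Real.cosh ((ν - 1) * t) =
        (Real.exp (ν * t + t) + Real.exp (-(ν * t) - t)) / 2
          - s * (Real.exp (ν * t) + Real.exp (-(ν * t)))
          + s ^ 2 * (Real.exp (ν * t - t) + Real.exp (-(ν * t) + t)) / 2 := by
      rw [Real.cosh_eq, Real.cosh_eq, Real.cosh_eq]
      rw [show (ν + 1) * t = ν * t + t by ring, show (ν - 1) * t = ν * t - t by ring,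
        show -(ν * t + t) = -(ν * t) - t by ring, show -(ν * t - t) = -(ν * t) + t by ring]
      ring
    have e2 : Real.cosh ((ν + 1) * t) - 2 * s * Real.cosh (ν * t) +
        s ^ 2 * Real.cosh ((ν - 1) * t) =
        Real.exp (ν * t - t) * (Real.exp t - s) ^ 2 / 2 +
          Real.exp (-(ν * t) + t) * (Real.exp (-t) - s) ^ 2 / 2 := by
      have hinv : Real.exp t * Real.exp (-t) = 1 := by rw [← Real.exp_add]; simp
      rw [e1, sub_eq_add_neg (ν * t), sub_eq_add_neg (-(ν * t))]
      simp only [Real.exp_add]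
      linear_combination (- Real.exp (ν * t) * (Real.exp t - 2 * s) / 2
        - Real.exp (-(ν * t)) * (Real.exp (-t) - 2 * s) / 2) * hinv
    have hne : Real.exp (-t) < Real.exp t := Real.exp_lt_exp.2 (by linarith)
    have e3 : 0 < Real.cosh ((ν + 1) * t) - 2 * s * Real.cosh (ν * t) +
        s ^ 2 * Real.cosh ((ν - 1) * t) := by
      rw [e2]
      by_cases h : Real.exp t = s
      · have : Real.exp (-t) - s ≠ 0 := by rw [← h]; linarith
        positivity
      · have : Real.exp t - s ≠ 0 := sub_ne_zero.2 h
        positivity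
    have := mul_pos (Real.exp_pos (-(x * Real.cosh t))) e3
    linarith
  have key := setIntegral_Ioi_pos_of_ne 0
    ((hp.sub (hn.const_mul (2 * s))).add (hm.const_mul (s ^ 2)))
    (fun t ht => (hpt t ht).le) (fun t ht _ => hpt t ht)
  erw [MeasureTheory.integral_add (hp.sub (hn.const_mul (2 * s))) (hm.const_mul (s ^ 2)),
    MeasureTheory.integral_sub hp (hn.const_mul (2 * s)),
    MeasureTheory.integral_const_mul, MeasureTheory.integral_const_mul] at key
  change 0 < besselK (ν + 1) x - 2 * s * besselK ν x + s ^ 2 * besselK (ν - 1) x at key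
  have h2 := mul_pos hmpos key
  have h3 : s * besselK (ν - 1) x = besselK ν x := by rw [hs]; field_simp
  have h4 : besselK (ν - 1) x * (besselK (ν + 1) x - 2 * s * besselK ν x +
      s ^ 2 * besselK (ν - 1) x) = besselK (ν - 1) x * besselK (ν + 1) x - besselK ν x ^ 2 := by
    linear_combination (-2 * besselK ν x + s * besselK (ν - 1) x + besselK ν x) * h3
  linarith

/-- Product-to-sum reduces this to comparing squared arguments, whose difference is `(2ν-1)(t²-s²)`.
-/
theorem cosh_mul_cosh_lt {ν s t : ℝ} (hν : 1 / 2 < ν) (hs : 0 ≤ s) (hst : s < t) :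
    Real.cosh ((ν - 1) * t) * Real.cosh (ν * s) <
      Real.cosh ((ν - 1) * s) * Real.cosh (ν * t) := by
  have h1 : Real.cosh ((ν - 1) * t + ν * s) < Real.cosh ((ν - 1) * s + ν * t) := by
    rw [Real.cosh_lt_cosh, ← sq_lt_sq]
    nlinarith [mul_pos (sub_pos.2 hst) (mul_pos (show 0 < 2 * ν - 1 by linarith)
      (show 0 < t + s by linarith))]
  have h2 : Real.cosh ((ν - 1) * t - ν * s) < Real.cosh ((ν - 1) * s - ν * t) := by
    rw [Real.cosh_lt_cosh, ← sq_lt_sq]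
    nlinarith [mul_pos (sub_pos.2 hst) (mul_pos (show 0 < 2 * ν - 1 by linarith)
      (show 0 < t + s by linarith))]
  rw [Real.cosh_add, Real.cosh_add] at h1
  rw [Real.cosh_sub, Real.cosh_sub] at h2
  linarith

theorem integral_cosh_mul_besselK_integrand (ν x : ℝ) (hx : 0 < x) :
    MeasureTheory.IntegrableOn (fun t => Real.cosh t *
      (Real.exp (-(x * Real.cosh t)) * Real.cosh (ν * t))) (Set.Ioi 0) ∧
    ∫ t in Set.Ioi (0 : ℝ), Real.cosh t *
      (Real.exp (-(x * Real.cosh t)) * Real.cosh (ν * t)) =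
        (besselK (ν + 1) x + besselK (ν - 1) x) / 2 := by
  have hp := integrableOn_besselK_integrand (ν + 1) x hx
  have hm := integrableOn_besselK_integrand (ν - 1) x hx
  have e : (fun t => Real.cosh t * (Real.exp (-(x * Real.cosh t)) * Real.cosh (ν * t))) =
      fun t => (Real.exp (-(x * Real.cosh t)) * Real.cosh ((ν + 1) * t) +
        Real.exp (-(x * Real.cosh t)) * Real.cosh ((ν - 1) * t)) / 2 := by
    funext t
    rw [show (ν + 1) * t = ν * t + t by ring, show (ν - 1) * t = ν * t - t by ring,
      Real.cosh_add, Real.cosh_sub]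
    ring
  rw [e]
  refine ⟨(hp.add hm).div_const 2, ?_⟩
  rw [MeasureTheory.integral_div, MeasureTheory.integral_add hp hm]
  rfl

theorem besselK_chebyshev (ν x : ℝ) (hν : 1 / 2 < ν) (hx : 0 < x) :
    besselK ν x * (besselK ν x + besselK (ν - 2) x) <
      besselK (ν - 1) x * (besselK (ν + 1) x + besselK (ν - 1) x) := by
  have hf := integrableOn_besselK_integrand (ν - 1) x hx
  have hg := integrableOn_besselK_integrand ν x hx
  obtain ⟨hcf, ecf⟩ := integral_cosh_mul_besselK_integrand (ν - 1) x hx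
  obtain ⟨hcg, ecg⟩ := integral_cosh_mul_besselK_integrand ν x hx
  have hK := besselK_pos ν x hx
  -- With this `c`, `φ` has weighted integral zero. It changes sign exactly once, at some `t₀`, so
  -- subtracting the constant `cosh t₀` costs nothing and gives the integrand a fixed sign.
  set c := besselK (ν - 1) x / besselK ν x with hc
  have hcK : c * besselK ν x = besselK (ν - 1) x := by rw [hc]; field_simp
  let φ : ℝ → ℝ := fun t => Real.cosh ((ν - 1) * t) - c * Real.cosh (ν * t)
  have hlt : besselK (ν - 1) x < besselK ν x := by
    have := setIntegral_Ioi_pos_of_ne 0 (hg.sub hf) (fun t ht => ?_) (fun t ht _ => ?_)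
    · erw [MeasureTheory.integral_sub hg hf] at this
      exact sub_pos.1 this
    all_goals
      have h := cosh_mul_cosh_lt hν le_rfl ht
      simp only [mul_zero, Real.cosh_zero, mul_one, one_mul] at h
      have := mul_lt_mul_of_pos_left h (Real.exp_pos (-(x * Real.cosh t)))
      simp only [Pi.sub_apply]
      linarith
  have hc1 : c < 1 := (div_lt_one hK).2 hlt
  have hint : MeasureTheory.IntegrableOn
      (fun t => Real.exp (-(x * Real.cosh t)) * φ t) (Set.Ioi 0) := by
    refine (hf.sub (hg.const_mul c)).congr (Filter.Eventually.of_forall fun t => ?_)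
    simp only [φ, Pi.sub_apply]
    ring
  have hzero : ∫ t in Set.Ioi (0 : ℝ), Real.exp (-(x * Real.cosh t)) * φ t = 0 := by
    have : ∀ t, Real.exp (-(x * Real.cosh t)) * φ t =
        Real.exp (-(x * Real.cosh t)) * Real.cosh ((ν - 1) * t) -
          c * (Real.exp (-(x * Real.cosh t)) * Real.cosh (ν * t)) := fun t => by
      simp only [φ]; ring
    simp_rw [this]
    rw [MeasureTheory.integral_sub hf (hg.const_mul c), MeasureTheory.integral_const_mul]
    change besselK (ν - 1) x - c * besselK ν x = 0
    linarith
  have hφ : Continuous φ := by fun_prop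
  obtain ⟨t₁, ht₁, hφt₁⟩ : ∃ t₁, 0 < t₁ ∧ φ t₁ ≤ 0 := by
    by_contra! h
    have := setIntegral_Ioi_pos_of_ne 0 hint
      (fun t ht => (mul_pos (Real.exp_pos _) (h t ht)).le)
      (fun t ht _ => mul_pos (Real.exp_pos _) (h t ht))
    linarith
  obtain ⟨t₀, ⟨ht₀, -⟩, hφt₀⟩ : (0 : ℝ) ∈ φ '' Set.Icc 0 t₁ :=
    intermediate_value_Icc' ht₁.le hφ.continuousOn ⟨hφt₁, by simp [φ]; exact hc1.le⟩
  have hc0 : Real.cosh ((ν - 1) * t₀) = c * Real.cosh (ν * t₀) := sub_eq_zero.1 hφt₀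
  have hsign : ∀ t, 0 < t → t ≠ t₀ → 0 < (Real.cosh t - Real.cosh t₀) * -φ t := by
    intro t ht hne
    have hgp := Real.cosh_pos (ν * t₀)
    rcases lt_or_gt_of_ne hne with h | h
    · have h1 := cosh_mul_cosh_lt hν ht.le h
      have h2 : Real.cosh t < Real.cosh t₀ := by
        rwa [Real.cosh_lt_cosh, abs_of_pos ht, abs_of_nonneg ht₀]
      have h3 : 0 < φ t := by
        rw [hc0] at h1
        have : 0 < φ t * Real.cosh (ν * t₀) := by simp only [φ]; linarith
        exact (pos_iff_pos_of_mul_pos this).2 hgp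
      nlinarith
    · have h1 := cosh_mul_cosh_lt hν ht₀ h
      have h2 : Real.cosh t₀ < Real.cosh t := by
        rwa [Real.cosh_lt_cosh, abs_of_pos ht, abs_of_nonneg ht₀]
      have h3 : 0 < -φ t := by
        rw [hc0] at h1
        have : 0 < -φ t * Real.cosh (ν * t₀) := by simp only [φ]; linarith
        exact (pos_iff_pos_of_mul_pos this).2 hgp
      exact mul_pos (sub_pos.2 h2) h3
  have hsplit : ∀ t, Real.exp (-(x * Real.cosh t)) * ((Real.cosh t - Real.cosh t₀) * -φ t) =
      c * (Real.cosh t * (Real.exp (-(x * Real.cosh t)) * Real.cosh (ν * t))) -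
      Real.cosh t * (Real.exp (-(x * Real.cosh t)) * Real.cosh ((ν - 1) * t)) +
      Real.cosh t₀ * (Real.exp (-(x * Real.cosh t)) * φ t) := fun t => by
    simp only [φ]; ring
  have hi := ((hcg.const_mul c).sub hcf).add (hint.const_mul (Real.cosh t₀))
  have key : 0 < ∫ t in Set.Ioi (0 : ℝ),
      Real.exp (-(x * Real.cosh t)) * ((Real.cosh t - Real.cosh t₀) * -φ t) := by
    refine setIntegral_Ioi_pos_of_ne t₀ ?_ (fun t ht => ?_)
      (fun t ht hne => mul_pos (Real.exp_pos _) (hsign t ht hne))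
    · exact hi.congr (Filter.Eventually.of_forall fun t => (hsplit t).symm)
    · rcases eq_or_ne t t₀ with rfl | hne
      · simp
      · exact (mul_pos (Real.exp_pos _) (hsign t ht hne)).le
  simp_rw [hsplit] at key
  erw [MeasureTheory.integral_add ((hcg.const_mul c).sub hcf) (hint.const_mul (Real.cosh t₀)),
    MeasureTheory.integral_sub (hcg.const_mul c) hcf, MeasureTheory.integral_const_mul,
    MeasureTheory.integral_const_mul, hzero, ecf, ecg] at key
  rw [show ν - 1 + 1 = ν by ring, show ν - 1 - 1 = ν - 2 by ring] at key
  have := mul_pos hK key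
  rw [← hcK] at this ⊢
  linarith

/-! ### The bounds as roots of a quadratic -/

theorem add_sqrt_pos (τ : ℝ) {x : ℝ} (hx : 0 < x) : 0 < τ + Real.sqrt (τ ^ 2 + x ^ 2) := by
  have : |τ| < Real.sqrt (τ ^ 2 + x ^ 2) := by
    rw [← Real.sqrt_sq_eq_abs]
    exact Real.sqrt_lt_sqrt (sq_nonneg _) (by nlinarith)
  linarith [neg_abs_le τ]

theorem div_add_sqrt_eq (τ : ℝ) {x : ℝ} (hx : 0 < x) :
    x / (τ + Real.sqrt (τ ^ 2 + x ^ 2)) = (Real.sqrt (τ ^ 2 + x ^ 2) - τ) / x := by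
  have h := Real.sq_sqrt (show 0 ≤ τ ^ 2 + x ^ 2 by positivity)
  rw [div_eq_div_iff (add_sqrt_pos τ hx).ne' hx.ne']
  linear_combination -h

theorem lt_div_add_sqrt_iff {τ x r : ℝ} (hx : 0 < x) (hr : 0 < r) :
    r < x / (τ + Real.sqrt (τ ^ 2 + x ^ 2)) ↔ x * r ^ 2 + 2 * τ * r < x := by
  have hp := add_sqrt_pos τ hx
  have h := Real.sq_sqrt (show 0 ≤ τ ^ 2 + x ^ 2 by positivity)
  rw [div_add_sqrt_eq τ hx, lt_div_iff₀ hx]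
  have e : x * (x - (x * r ^ 2 + 2 * τ * r)) =
      (Real.sqrt (τ ^ 2 + x ^ 2) - τ - r * x) * (r * x + (τ + Real.sqrt (τ ^ 2 + x ^ 2))) := by
    linear_combination -h
  have hq : 0 < r * x + (τ + Real.sqrt (τ ^ 2 + x ^ 2)) := by positivity
  rw [← sub_pos, ← mul_pos_iff_of_pos_right hq, ← e, mul_pos_iff_of_pos_left hx, sub_pos]

theorem div_add_sqrt_lt_iff {τ x r : ℝ} (hx : 0 < x) (hr : 0 < r) :
    x / (τ + Real.sqrt (τ ^ 2 + x ^ 2)) < r ↔ x < x * r ^ 2 + 2 * τ * r := by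
  have hp := add_sqrt_pos τ hx
  have h := Real.sq_sqrt (show 0 ≤ τ ^ 2 + x ^ 2 by positivity)
  rw [div_add_sqrt_eq τ hx, div_lt_iff₀ hx]
  have e : x * ((x * r ^ 2 + 2 * τ * r) - x) =
      (r * x - (Real.sqrt (τ ^ 2 + x ^ 2) - τ)) * (r * x + (τ + Real.sqrt (τ ^ 2 + x ^ 2))) := by
    linear_combination h
  have hq : 0 < r * x + (τ + Real.sqrt (τ ^ 2 + x ^ 2)) := by positivity
  rw [← sub_pos, ← mul_pos_iff_of_pos_right hq, ← e, mul_pos_iff_of_pos_left hx, sub_pos]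

theorem dBound_strictMono (ν : ℝ) {x : ℝ} (hx : 0 < x) :
    StrictMono (fun α : ℝ => dBound α ν x) := by
  intro α β hαβ
  have hd : 0 < dBound α ν x := div_pos hx (add_sqrt_pos _ hx)
  refine (lt_div_add_sqrt_iff hx hd).2 ?_
  -- `h` and `h'` together say that `dBound α ν x` solves its own quadratic; raising `α` lowers `τ`.
  have h := (lt_div_add_sqrt_iff (τ := ν - (α + 1) / 2) hx hd).not.1 (lt_irrefl _)
  have h' := (div_add_sqrt_lt_iff (τ := ν - (α + 1) / 2) hx hd).not.1 (lt_irrefl _)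
  nlinarith

/-! ### The two bounds -/

theorem besselK_ratio_lt (ν x : ℝ) (hx : 0 < x) :
    besselK (ν - 1) x / besselK ν x < x / ((ν - 1) + Real.sqrt ((ν - 1) ^ 2 + x ^ 2)) := by
  have h1 := besselK_sq_lt (ν - 1) x hx
  have h2 := besselK_recurrence (ν - 1) x hx
  have hK := besselK_pos ν x hx
  have hM := besselK_pos (ν - 1) x hx
  rw [sub_add_cancel] at h1 h2
  rw [lt_div_add_sqrt_iff hx (div_pos hM hK), ← sub_pos]
  have : x - (x * (besselK (ν - 1) x / besselK ν x) ^ 2 +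
      2 * (ν - 1) * (besselK (ν - 1) x / besselK ν x)) =
      x * (besselK (ν - 1 - 1) x * besselK ν x - besselK (ν - 1) x ^ 2) / besselK ν x ^ 2 := by
    field_simp
    linear_combination besselK ν x * h2
  rw [this]
  have := sub_pos.2 h1
  positivity

theorem lt_besselK_ratio (ν x : ℝ) (hν : 1 / 2 < ν) (hx : 0 < x) :
    x / ((ν - 1 / 2) + Real.sqrt ((ν - 1 / 2) ^ 2 + x ^ 2)) <
      besselK (ν - 1) x / besselK ν x := by
  have h1 := besselK_chebyshev ν x hν hx
  have h2 := besselK_recurrence (ν - 1) x hx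
  have h3 := besselK_recurrence ν x hx
  have hK := besselK_pos ν x hx
  have hM := besselK_pos (ν - 1) x hx
  rw [sub_add_cancel, show ν - 1 - 1 = ν - 2 by ring] at h2
  rw [div_add_sqrt_lt_iff hx (div_pos hM hK), ← sub_pos]
  have : x * (besselK (ν - 1) x / besselK ν x) ^ 2 +
      2 * (ν - 1 / 2) * (besselK (ν - 1) x / besselK ν x) - x =
      x * (besselK (ν - 1) x * (besselK (ν + 1) x + besselK (ν - 1) x) -
        besselK ν x * (besselK ν x + besselK (ν - 2) x)) / (2 * besselK ν x ^ 2) := by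
    field_simp
    linear_combination -besselK (ν - 1) x * h3 - besselK ν x * h2
  rw [this]
  have := sub_pos.2 h1
  positivity

theorem besselK_ratio_one_half (x : ℝ) (hx : 0 < x) :
    besselK (1 / 2 - 1) x / besselK (1 / 2) x = 1 := by
  rw [show (1 / 2 - 1 : ℝ) = -(1 / 2) by norm_num, besselK_neg]
  exact div_self (besselK_pos _ _ hx).ne'

theorem div_add_sqrt_zero {x : ℝ} (hx : 0 < x) :
    x / ((1 / 2 - 1 / 2) + Real.sqrt ((1 / 2 - 1 / 2) ^ 2 + x ^ 2)) = 1 := by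
  simp [Real.sqrt_sq hx.le, hx.ne']

theorem le_besselK_ratio (ν x : ℝ) (hν : 1 / 2 ≤ ν) (hx : 0 < x) :
    x / ((ν - 1 / 2) + Real.sqrt ((ν - 1 / 2) ^ 2 + x ^ 2)) ≤
      besselK (ν - 1) x / besselK ν x := by
  rcases hν.eq_or_lt with rfl | h
  · rw [besselK_ratio_one_half x hx, div_add_sqrt_zero hx]
  · exact (lt_besselK_ratio ν x h hx).le

/-! ### Optimality of the lower bound -/

/-- The lower bound at order `ν + 1` bounds `K_{ν+1}/K_ν` above, and the recurrence subtracts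
`2ν/x`. Unlike `d_1`, the result has the right `1/x` term at infinity. -/
theorem besselK_ratio_lt_sqrt (ν x : ℝ) (hν : -(1 / 2) < ν) (hx : 0 < x) :
    besselK (ν - 1) x / besselK ν x <
      (Real.sqrt ((ν + 1 / 2) ^ 2 + x ^ 2) - (ν - 1 / 2)) / x := by
  have h1 := lt_besselK_ratio (ν + 1) x (by linarith) hx
  have h2 := besselK_recurrence ν x hx
  have hK := besselK_pos ν x hx
  have hP := besselK_pos (ν + 1) x hx
  rw [add_sub_cancel_right, show ν + 1 - 1 / 2 = ν + 1 / 2 by ring,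
    div_lt_div_iff₀ (add_sqrt_pos _ hx) hP] at h1
  rw [div_lt_div_iff₀ hK hx]
  linarith

theorem alpha_nonpos_of_dBound_le {ν α : ℝ} (hν : 1 / 2 ≤ ν)
    (h : ∀ x : ℝ, 0 < x → dBound α ν x ≤ besselK (ν - 1) x / besselK ν x) : α ≤ 0 := by
  by_contra! hα
  set c := (ν + 1 / 2) ^ 2 with hc
  -- Chosen so that `αx ≥ c`, whence `c + x² ≤ (x + α/2)²`.
  have hx : 0 < c / α + 1 := by positivity
  set x := c / α + 1 with hxdef
  have h1 := (h x hx).trans_lt (besselK_ratio_lt_sqrt ν x (by linarith) hx)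
  unfold dBound at h1
  rw [div_add_sqrt_eq _ hx, div_lt_div_iff_of_pos_right hx] at h1
  have h2 : x ≤ Real.sqrt ((ν - (α + 1) / 2) ^ 2 + x ^ 2) :=
    Real.le_sqrt_of_sq_le (by nlinarith [sq_nonneg (ν - (α + 1) / 2)])
  have h3 : Real.sqrt (c + x ^ 2) ≤ x + α / 2 := by
    refine Real.sqrt_le_iff.2 ⟨by positivity, ?_⟩
    have : α * x = c + α := by rw [hxdef]; field_simp
    nlinarith [sq_nonneg α]
  linarith

/-! ### Optimality of the upper bound -/

theorem cosh_mul_le_const_add_sinh {a ε : ℝ} (ha0 : 0 ≤ a) (ha1 : a < 1) (hε : 0 < ε) :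
    ∃ C : ℝ, 0 < C ∧ ∀ t : ℝ, 0 ≤ t → Real.cosh (a * t) ≤ C + ε * Real.sinh t := by
  -- Beyond `T`, `exp (a t) ≤ (ε/2) exp t`.
  set T := max 0 (-Real.log (ε / 2) / (1 - a)) with hT
  refine ⟨Real.exp (a * T) + ε / 2, by positivity, fun t ht => ?_⟩
  have h0 := cosh_mul_le_exp_abs_mul a t ht
  rw [abs_of_nonneg ha0] at h0
  have h1 : Real.exp t ≤ 2 * Real.sinh t + 1 := by
    have : Real.exp (-t) ≤ 1 := Real.exp_le_one_iff.2 (by linarith)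
    rw [Real.sinh_eq]; linarith
  have hs : 0 ≤ Real.sinh t := Real.sinh_nonneg_iff.2 ht
  rcases le_total t T with h | h
  · have : Real.exp (a * t) ≤ Real.exp (a * T) :=
      Real.exp_le_exp.2 (mul_le_mul_of_nonneg_left h ha0)
    have := mul_nonneg hε.le hs
    linarith
  · have h2 : -Real.log (ε / 2) / (1 - a) ≤ t := (le_max_right _ _).trans h
    rw [div_le_iff₀ (by linarith)] at h2
    have h3 : Real.exp (a * t) ≤ ε / 2 * Real.exp t := by
      conv_rhs => rw [← Real.exp_log (half_pos hε), ← Real.exp_add]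
      exact Real.exp_le_exp.2 (by linarith)
    have := Real.exp_pos (a * T)
    nlinarith

theorem besselK_anti (ν : ℝ) {x y : ℝ} (hx : 0 < x) (hxy : x ≤ y) :
    besselK ν y ≤ besselK ν x := by
  refine MeasureTheory.setIntegral_mono (integrableOn_besselK_integrand ν y (hx.trans_le hxy))
    (integrableOn_besselK_integrand ν x hx) fun t => ?_
  have := Real.cosh_pos t
  have := Real.cosh_pos (ν * t)
  dsimp only
  gcongr

theorem besselK_le_of_abs_le {μ ν x : ℝ} (h : |μ| ≤ |ν|) (hx : 0 < x) :
    besselK μ x ≤ besselK ν x := by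
  refine MeasureTheory.setIntegral_mono (integrableOn_besselK_integrand μ x hx)
    (integrableOn_besselK_integrand ν x hx) fun t => ?_
  refine mul_le_mul_of_nonneg_left (Real.cosh_le_cosh.2 ?_) (Real.exp_pos _).le
  rw [abs_mul, abs_mul]
  exact mul_le_mul_of_nonneg_right h (abs_nonneg t)

theorem integral_exp_neg_cosh_mul_sinh (x : ℝ) (hx : 0 < x) :
    MeasureTheory.IntegrableOn
      (fun t => Real.exp (-(x * Real.cosh t)) * Real.sinh t) (Set.Ioi 0) ∧
    x * ∫ t in Set.Ioi (0 : ℝ), Real.exp (-(x * Real.cosh t)) * Real.sinh t ≤ 1 := by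
  have hi : MeasureTheory.IntegrableOn
      (fun t => Real.exp (-(x * Real.cosh t)) * Real.sinh t) (Set.Ioi 0) := by
    refine (integrableOn_besselK_integrand 1 x hx).mono'
      (Continuous.aestronglyMeasurable (by fun_prop)) ?_
    filter_upwards [MeasureTheory.ae_restrict_mem measurableSet_Ioi] with t ht
    have hs : 0 ≤ Real.sinh t := Real.sinh_nonneg_iff.2 (Set.mem_Ioi.1 ht).le
    rw [Real.norm_of_nonneg (by positivity), one_mul]
    exact mul_le_mul_of_nonneg_left (Real.sinh_lt_cosh t).le (Real.exp_pos _).le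
  refine ⟨hi, ?_⟩
  have hderiv : ∀ t ∈ Set.Ici (0 : ℝ), HasDerivAt (fun t => -Real.exp (-(x * Real.cosh t)))
      (x * (Real.exp (-(x * Real.cosh t)) * Real.sinh t)) t := by
    intro t _
    refine ((((Real.hasDerivAt_cosh t).const_mul x).neg).exp).neg.congr_deriv ?_
    simp only [Pi.neg_apply]
    ring
  have hlim : Filter.Tendsto (fun t => -Real.exp (-(x * Real.cosh t))) Filter.atTop (nhds 0) := by
    have hc : Filter.Tendsto Real.cosh Filter.atTop Filter.atTop :=
      Filter.tendsto_atTop_mono' _ ((Filter.eventually_ge_atTop 0).mono fun t ht =>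
        (Real.self_le_sinh_iff.2 ht).trans (Real.sinh_lt_cosh t).le) Filter.tendsto_id
    simpa using (Real.tendsto_exp_neg_atTop_nhds_zero.comp (hc.const_mul_atTop hx)).neg
  have key := MeasureTheory.integral_Ioi_of_hasDerivAt_of_tendsto' hderiv (hi.const_mul x) hlim
  rw [MeasureTheory.integral_const_mul] at key
  rw [key, Real.cosh_zero, mul_one, zero_sub, neg_neg]
  exact Real.exp_le_one_iff.2 (by linarith)

/-- Makes the `K_{ν-2}` term of the recurrence negligible near `0`, with `μ = ν - 1`. For `μ < 1/2`,
`cosh ((1-μ)t)` is at most a constant plus a small multiple of `sinh t`, whose weighted integral is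
at most `1/x`. -/
theorem exists_mul_besselK_lt {μ η : ℝ} (hμ : 0 < μ) (hη : 0 < η) :
    ∃ x : ℝ, 0 < x ∧ x * besselK (μ - 1) x < η * besselK μ x := by
  rcases le_or_gt (1 / 2) μ with h | h
  · refine ⟨η / 2, by positivity, ?_⟩
    have h1 : besselK (μ - 1) (η / 2) ≤ besselK μ (η / 2) :=
      besselK_le_of_abs_le (by rw [abs_of_pos hμ, abs_le]; constructor <;> linarith)
        (by positivity)
    have := besselK_pos μ (η / 2) (by positivity)
    nlinarith
  · have hk := besselK_pos μ 1 one_pos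
    obtain ⟨C, hC, hCt⟩ := cosh_mul_le_const_add_sinh (a := 1 - μ) (by linarith) (by linarith)
      (show 0 < η * besselK μ 1 / 4 by positivity)
    have hx : 0 < min 1 (η / (4 * C)) := by positivity
    refine ⟨min 1 (η / (4 * C)), hx, ?_⟩
    set x := min 1 (η / (4 * C)) with hxdef
    have hx1 : x ≤ 1 := min_le_left _ _
    have hx2 : x * C ≤ η / 4 := by
      have : x ≤ η / (4 * C) := min_le_right _ _
      rw [le_div_iff₀ (by positivity)] at this
      linarith
    obtain ⟨hi, hle⟩ := integral_exp_neg_cosh_mul_sinh x hx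
    have h0 := integrableOn_besselK_integrand 0 x hx
    have h1 : besselK (μ - 1) x ≤ C * besselK 0 x + η * besselK μ 1 / 4 *
        ∫ t in Set.Ioi (0 : ℝ), Real.exp (-(x * Real.cosh t)) * Real.sinh t := by
      rw [← besselK_neg, neg_sub]
      unfold besselK
      rw [← MeasureTheory.integral_const_mul, ← MeasureTheory.integral_const_mul,
        ← MeasureTheory.integral_add (h0.const_mul C) (hi.const_mul _)]
      refine MeasureTheory.setIntegral_mono_on (integrableOn_besselK_integrand _ x hx)
        ((h0.const_mul C).add (hi.const_mul _)) measurableSet_Ioi fun t ht => ?_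
      have := mul_le_mul_of_nonneg_left (hCt t (Set.mem_Ioi.1 ht).le)
        (Real.exp_pos (-(x * Real.cosh t))).le
      rw [zero_mul, Real.cosh_zero]
      unfold besselK at this
      linarith
    have h2 : besselK 0 x ≤ besselK μ x := besselK_le_of_abs_le (by simp) hx
    have h3 : besselK μ 1 ≤ besselK μ x := besselK_anti μ hx hx1
    have hK := besselK_pos μ x hx
    have h4 := mul_le_mul_of_nonneg_left h1 hx.le
    have h5 : x * C * besselK 0 x ≤ η / 4 * besselK μ x :=
      mul_le_mul hx2 h2 (besselK_pos 0 x hx).le (by positivity)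
    have h6 := mul_le_mul_of_nonneg_left hle (show 0 ≤ η * besselK μ 1 / 4 by positivity)
    have h7 := mul_le_mul_of_nonneg_left h3 hη.le
    have h8 := mul_pos hη hK
    linarith

theorem one_le_alpha_of_le_dBound {ν α : ℝ} (hν : 1 < ν)
    (h : ∀ x : ℝ, 0 < x → besselK (ν - 1) x / besselK ν x ≤ dBound α ν x) : 1 ≤ α := by
  by_contra! hα
  -- The slack `1 - α` is exactly `2τ - 2(ν - 1)`.
  obtain ⟨x, hx, hlt⟩ := exists_mul_besselK_lt (sub_pos.2 hν) (sub_pos.2 hα)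
  have hK := besselK_pos ν x hx
  have hM := besselK_pos (ν - 1) x hx
  have h1 := h x hx
  have h2 := besselK_recurrence (ν - 1) x hx
  rw [sub_add_cancel] at h2
  have hτ : 0 < ν - (α + 1) / 2 := by linarith
  have h3 : ν - (α + 1) / 2 ≤ Real.sqrt ((ν - (α + 1) / 2) ^ 2 + x ^ 2) :=
    Real.le_sqrt_of_sq_le (by nlinarith)
  unfold dBound at h1
  rw [div_le_div_iff₀ hK (add_sqrt_pos _ hx)] at h1
  have h4 := mul_le_mul_of_nonneg_left h3 hM.le
  linarith

theorem theorem7 :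
    -- the lower bound, with equality exactly at `ν = 1/2`
    (∀ ν x : ℝ, 1 / 2 ≤ ν → 0 < x →
      x / ((ν - 1 / 2) + Real.sqrt ((ν - 1 / 2) ^ 2 + x ^ 2)) ≤ besselK (ν - 1) x / besselK ν x ∧
      (besselK (ν - 1) x / besselK ν x = x / ((ν - 1 / 2) + Real.sqrt ((ν - 1 / 2) ^ 2 + x ^ 2)) ↔
        ν = 1 / 2)) ∧
    -- the strict upper bound, for all real orders
    (∀ ν x : ℝ, 0 < x →
      besselK (ν - 1) x / besselK ν x < x / ((ν - 1) + Real.sqrt ((ν - 1) ^ 2 + x ^ 2))) ∧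
    -- the two bounds are the members `α = 0` and `α = 1` of the family `d_α`,
    -- and the family is strictly increasing in `α`
    (∀ ν x : ℝ, 0 < x →
      dBound 0 ν x = x / ((ν - 1 / 2) + Real.sqrt ((ν - 1 / 2) ^ 2 + x ^ 2)) ∧
      dBound 1 ν x = x / ((ν - 1) + Real.sqrt ((ν - 1) ^ 2 + x ^ 2)) ∧
      StrictMono (fun α : ℝ => dBound α ν x)) ∧
    -- the lower bound is the best one in the family, for each fixed `ν ≥ 1/2`
    (∀ ν : ℝ, 1 / 2 ≤ ν → ∀ α : ℝ,
      ((∀ x : ℝ, 0 < x → dBound α ν x ≤ besselK (ν - 1) x / besselK ν x) ↔ α ≤ 0)) ∧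
    -- the upper bound is the best one in the family that is valid for all real `ν`
    (∀ α : ℝ,
      ((∀ ν x : ℝ, 0 < x → besselK (ν - 1) x / besselK ν x ≤ dBound α ν x) ↔ 1 ≤ α)) ∧
    -- and it is already the best one for each fixed `ν > 1`
    (∀ ν : ℝ, 1 < ν → ∀ α : ℝ,
      ((∀ x : ℝ, 0 < x → besselK (ν - 1) x / besselK ν x ≤ dBound α ν x) ↔ 1 ≤ α)) := by
  have h0 : ∀ ν x : ℝ, dBound 0 ν x =
      x / ((ν - 1 / 2) + Real.sqrt ((ν - 1 / 2) ^ 2 + x ^ 2)) := fun ν x => by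
    rw [dBound, zero_add]
  have h1 : ∀ ν x : ℝ, dBound 1 ν x = x / ((ν - 1) + Real.sqrt ((ν - 1) ^ 2 + x ^ 2)) :=
    fun ν x => by rw [dBound, add_self_div_two]
  have hupper : ∀ α : ℝ, 1 ≤ α → ∀ ν x : ℝ, 0 < x →
      besselK (ν - 1) x / besselK ν x ≤ dBound α ν x := fun α hα ν x hx =>
    ((besselK_ratio_lt ν x hx).le.trans_eq (h1 ν x).symm).trans
      ((dBound_strictMono ν hx).monotone hα)
  refine ⟨fun ν x hν hx => ⟨le_besselK_ratio ν x hν hx, fun h => ?_, ?_⟩, besselK_ratio_lt,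
    fun ν x hx => ⟨h0 ν x, h1 ν x, dBound_strictMono ν hx⟩,
    fun ν hν α => ⟨alpha_nonpos_of_dBound_le hν, fun hα x hx => ?_⟩,
    fun α => ⟨fun h => one_le_alpha_of_le_dBound one_lt_two (h 2), hupper α⟩,
    fun ν hν α => ⟨one_le_alpha_of_le_dBound hν, fun hα => hupper α hα ν⟩⟩
  · by_contra hne
    exact (lt_besselK_ratio ν x (lt_of_le_of_ne hν (Ne.symm hne)) hx).ne h.symm
  · rintro rfl
    rw [besselK_ratio_one_half x hx, div_add_sqrt_zero hx]
  · exact ((dBound_strictMono ν hx).monotone hα).trans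
      ((h0 ν x).trans_le (le_besselK_ratio ν x hν hx))
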